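/- Let $\mathcal A$ be a unital C*-algebra and let $\varphi:\mathcal A\to\mathbb C$ be a positive linear functional of norm $1$. For $a\in\mathcal A$, a probability measure $\mu$ on $\mathbb R$ is called the law of $a$ if all its moments are finite and $\varphi(a^n)=\int x^n\,d\mu(x)$ for all $n\ge 0$. Elements $(a_i)_{i\ge1}$ are freely independent if, writing $\mathcal A_i$ for the unital subalgebra generated by $a_i$, one has $\varphi(x_1\cdots x_r)=0$ whenever $r\ge2$, $x_k\in\mathcal A_{j_k}$, $\varphi(x_k)=0$ for $1\le k\le r$, and $j_1\ne j_2,\ j_2\neq j_3,\dots,\ j_{r-1}\ne j_r$. A semicircular element $s$ of a C*-probability space $(\mathcal B,\psi)$ is a self-adjoint element whose law is the semicircle law $d\rho(x)=\frac1{2\pi}\sqrt{(4-x^2)_+}\,dx$. **Theorem (Free Central Limit Theorem).** Let $(a_i)_{i\ge 1}$ be freely independent self-adjoint elements of $\mathcal A$ with $\varphi(a_i)=0$ and $\varphi(a_i^2)=1$ for all $i$, all having the same law $\mu$, where $\int|x|^3\,d\mu(x)<\infty$. Put $S_N=\frac1{\sqrt N}\sum_{i=1}^N a_i$. Then $S_N$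 converges in distribution, as $N\to\infty$, to a semicircular element $s$ (of some C*-probability space $(\mathcal B,\psi)$). That is, $\varphi(S_N^k)\to\psi(s^k)$ for every $k\ge0$, and each $S_N$ has a law, with these laws converging weakly to the law of $s$. -/

import Mathlib

namespace FreeProb

section ProbabilitySpace

variable {A : Type*} [CStarAlgebra A]

open scoped ComplexOrder in
/-- `φ` is a state on the unital C*-algebra `A`: it is positive and has norm `1`.
A pair `(A, φ)` of this kind is a C*-probability space. -/
def IsState (φ : A →L[ℂ] ℂ) : Prop :=
  (∀ x : A, 0 ≤ φ (star x * x)) ∧ ‖φ‖ = 1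

/-- Free independence of a family of unital subalgebras with respect to `φ`:
every alternating product of centred elements is centred. -/
def FreeSubalgebras (φ : A →L[ℂ] ℂ) {ι : Type*} (𝒜 : ι → Subalgebra ℂ A) : Prop :=
  ∀ r : ℕ, 2 ≤ r → ∀ (x : Fin r → A) (j : Fin r → ι),
    (∀ k, φ (x k) = 0) →
    (∀ k, x k ∈ 𝒜 (j k)) →
    (∀ k l : Fin r, (l : ℕ) = k + 1 → j k ≠ j l) →
    φ (List.ofFn x).prod = 0

/-- Free independence of a family of elements: the unital subalgebras
generated by the single elements are free. -/
def FreelyIndependent (φ : A →L[ℂ] ℂ) {ι : Type*} (a : ι → A) : Prop :=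
  FreeSubalgebras φ fun i => Algebra.adjoin ℂ {a i}

/-- The probability measure `μ` on the line is the law of `a`: all moments of `μ` are finite
and they coincide with the moments `φ (a ^ n)` of `a`. -/
def IsLaw (φ : A →L[ℂ] ℂ) (a : A) (μ : MeasureTheory.ProbabilityMeasure ℝ) : Prop :=
  ∀ n : ℕ, MeasureTheory.Integrable (fun x : ℝ => x ^ n) (μ : MeasureTheory.Measure ℝ) ∧
    φ (a ^ n) = ((∫ x : ℝ, x ^ n ∂(μ : MeasureTheory.Measure ℝ) : ℝ) : ℂ)

/-- Convergence in distribution of the elements `b N` of `(A, φ)` to the element `s` of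
`(B, ψ)`: all moments converge, and the laws (which exist) converge weakly to the law of `s`.
The topology on `ProbabilityMeasure ℝ` is that of weak convergence. -/
def ConvergesInDistribution {B : Type*} [CStarAlgebra B]
    (φ : A →L[ℂ] ℂ) (b : ℕ → A) (ψ : B →L[ℂ] ℂ) (s : B) : Prop :=
  (∀ k : ℕ, Filter.Tendsto (fun N => φ (b N ^ k)) Filter.atTop (nhds (ψ (s ^ k)))) ∧
  ∃ (ν : ℕ → MeasureTheory.ProbabilityMeasure ℝ) (ν' : MeasureTheory.ProbabilityMeasure ℝ),
    (∀ N, IsLaw φ (b N) (ν N)) ∧ IsLaw ψ s ν' ∧ Filter.Tendsto ν Filter.atTop (nhds ν')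

end ProbabilitySpace

/-- The density `(2π)⁻¹ √((4 - x²)₊)` of the semicircle law. -/
noncomputable def semicircleDensity (x : ℝ) : ℝ :=
  1 / (2 * Real.pi) * Real.sqrt (max (4 - x ^ 2) 0)

theorem semicircleDensity_nonneg (x : ℝ) : 0 ≤ semicircleDensity x := by
  unfold semicircleDensity; positivity

theorem continuous_semicircleDensity : Continuous semicircleDensity := by
  unfold semicircleDensity; fun_prop

theorem semicircleDensity_eq_zero {x : ℝ} (hx : x ∉ Set.Ioc (-2 : ℝ) 2) :
    semicircleDensity x = 0 := by
  have h : 4 - x ^ 2 ≤ 0 := by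
    by_contra h
    apply hx
    constructor <;> nlinarith
  simp [semicircleDensity, max_eq_right h]

theorem integral_semicircleDensity : ∫ x, semicircleDensity x = 1 := by
  rw [← MeasureTheory.setIntegral_eq_integral_of_forall_compl_eq_zero
    (fun x hx => semicircleDensity_eq_zero hx),
    ← intervalIntegral.integral_of_le (by norm_num : (-2 : ℝ) ≤ 2)]
  have h := intervalIntegral.integral_comp_mul_left (a := -1) (b := 1) semicircleDensity
    (two_ne_zero' ℝ)
  have h2 : ∀ x ∈ Set.uIcc (-1 : ℝ) 1,
      semicircleDensity (2 * x) = 1 / Real.pi * Real.sqrt (1 - x ^ 2) := by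
    intro x hx
    rw [Set.uIcc_of_le (by norm_num)] at hx
    have h0 : 0 ≤ 1 - x ^ 2 := by nlinarith [hx.1, hx.2]
    have h4 : (4 : ℝ) - (2 * x) ^ 2 = 2 ^ 2 * (1 - x ^ 2) := by ring
    rw [semicircleDensity, max_eq_left (by rw [h4]; positivity), h4,
      Real.sqrt_mul (by norm_num), Real.sqrt_sq (by norm_num)]
    field_simp
  rw [intervalIntegral.integral_congr h2, intervalIntegral.integral_const_mul,
    integral_sqrt_one_sub_sq] at h
  norm_num at h
  field_simp at h
  linarith

/-- The semicircle law `dρ(x) = (2π)⁻¹ √((4 - x²)₊) dx`. -/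
noncomputable def semicircleLaw : MeasureTheory.ProbabilityMeasure ℝ :=
  ⟨MeasureTheory.volume.withDensity fun x => ENNReal.ofReal (semicircleDensity x), by
    constructor
    have hi : MeasureTheory.Integrable semicircleDensity := by
      by_contra h
      have := integral_semicircleDensity
      rw [MeasureTheory.integral_undef h] at this
      norm_num at this
    rw [MeasureTheory.withDensity_apply _ MeasurableSet.univ, MeasureTheory.setLIntegral_univ,
      ← MeasureTheory.ofReal_integral_eq_lintegral_ofReal hi
        (Filter.Eventually.of_forall semicircleDensity_nonneg),
      integral_semicircleDensity, ENNReal.ofReal_one]⟩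

/-- A semicircular element: a self-adjoint element whose moments are those of the
semicircle law. -/
def IsSemicircular {B : Type*} [CStarAlgebra B] (ψ : B →L[ℂ] ℂ) (s : B) : Prop :=
  IsSelfAdjoint s ∧ IsLaw ψ s semicircleLaw

end FreeProb

/-! Write `S = y + ε a_i` with `ε = 1/√N` and `y` the normalized sum of the other elements, so that
`φ(S^(k+1)) = ∑_i ε φ(a_i S^k)`. Expand `S^k` in `ε`. By freeness of `a_i` and `y`, the zeroth order
term `φ(a_i y^k)` vanishes, and `φ(a_i y^j a_i y^(k-1-j)) = φ(y^j) φ(y^(k-1-j))` evaluates the first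
order term (`ListFree.map_mul_add_pow`). What remains in each summand is `ε^3` times a mixed moment,
and `y` may be replaced by `S` at cost `O(ε)`. As there are `N = ε^(-2)` summands, the moments `m_k`
of `S` satisfy `m_(k+1) = ∑_{j<k} m_j m_(k-1-j) + O(ε)`. This is the Catalan recursion, which the
semicircle moments satisfy exactly (`semicircleMoment_succ`), so the moments converge by induction.

Two facts about freeness support this. Grouping a free family keeps it free (`ListFree.group`), so
`a_i` is free from `y`. Mixed moments are bounded by moments of the single letters
(`isBdd_listValue`), with degree in `y` controlled by a weight; this lets the bound on order `k+1`
use only orders up to `k` (`momentsBounded`).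

Laws of self-adjoint elements come from functional calculus and Riesz representation. Since the
semicircle law has compact support, convergence of moments upgrades to weak convergence
(`tendsto_of_tendsto_moments`). -/

namespace FreeProb

/-! ### Reduced words and associativity of freeness. -/

section Freeness

variable {A : Type*} [CStarAlgebra A] {φ : A →L[ℂ] ℂ} {ι κ : Type*}

/-- An alternating word of centred elements of the subalgebras `𝒜 i`. -/
def IsReduced (φ : A →L[ℂ] ℂ) (𝒜 : ι → Subalgebra ℂ A) (L : List (ι × A)) : Prop :=
  L.IsChain (fun p q => p.1 ≠ q.1) ∧ ∀ p ∈ L, p.2 ∈ 𝒜 p.1 ∧ φ p.2 = 0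

/-- Freeness in terms of lists: nonempty reduced words have expectation zero. -/
def ListFree (φ : A →L[ℂ] ℂ) (𝒜 : ι → Subalgebra ℂ A) : Prop :=
  ∀ L : List (ι × A), L ≠ [] → IsReduced φ 𝒜 L → φ (L.map Prod.snd).prod = 0

/-- The definition covers words of length at least two; a one-letter word is killed because its
letter is centred. -/
theorem FreeSubalgebras.listFree {𝒜 : ι → Subalgebra ℂ A} (h : FreeSubalgebras φ 𝒜) :
    ListFree φ 𝒜 := by
  rintro L hne ⟨hchain, hL⟩
  match L, hne with
  | [p], _ => simpa using (hL p (by simp)).2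
  | p :: q :: L, _ =>
    have hlen : 2 ≤ (p :: q :: L).length := by simp
    generalize p :: q :: L = M at *
    have key := h M.length hlen (fun k => (M.get k).2) (fun k => (M.get k).1)
      (fun k => (hL _ (List.get_mem _ _)).2) (fun k => (hL _ (List.get_mem _ _)).1) ?_
    · rw [← key]
      congr 2
      apply List.ext_get
      · simp
      · intro n h1 h2
        simp
    · rintro ⟨k, hk⟩ ⟨l, hl⟩ rfl
      exact List.isChain_iff_getElem.1 hchain k hl

theorem sub_smul_one_centred (h1 : φ 1 = 1) (x : A) : φ (x - φ x • (1 : A)) = 0 := by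
  simp [h1]

/-- Products of nonempty reduced words all of whose letters satisfy `P`. -/
noncomputable def reducedSpan (φ : A →L[ℂ] ℂ) (𝒜 : ι → Subalgebra ℂ A) (P : ι → Prop) :
    Submodule ℂ A :=
  Submodule.span ℂ {x | ∃ L : List (ι × A), L ≠ [] ∧ IsReduced φ 𝒜 L ∧ (∀ p ∈ L, P p.1) ∧
    (L.map Prod.snd).prod = x}

/-- Products of nonempty reduced words whose first letter satisfies `P`. -/
noncomputable def reducedHeadSpan (φ : A →L[ℂ] ℂ) (𝒜 : ι → Subalgebra ℂ A) (P : ι → Prop) :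
    Submodule ℂ A :=
  Submodule.span ℂ {x | ∃ L : List (ι × A), L ≠ [] ∧ IsReduced φ 𝒜 L ∧ (∀ p ∈ L.head?, P p.1) ∧
    (L.map Prod.snd).prod = x}

variable {𝒜 : ι → Subalgebra ℂ A}

theorem IsReduced.tail {p : ι × A} {L : List (ι × A)} (h : IsReduced φ 𝒜 (p :: L)) :
    IsReduced φ 𝒜 L :=
  ⟨(List.isChain_cons.1 h.1).2, fun q hq => h.2 q (List.mem_cons_of_mem _ hq)⟩

theorem IsReduced.cons {p : ι × A} {L : List (ι × A)} (hL : IsReduced φ 𝒜 L)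
    (hp : p.2 ∈ 𝒜 p.1) (h0 : φ p.2 = 0) (hne : ∀ q ∈ L.head?, p.1 ≠ q.1) :
    IsReduced φ 𝒜 (p :: L) := by
  refine ⟨List.isChain_cons.2 ⟨hne, hL.1⟩, ?_⟩
  intro q hq
  rcases List.mem_cons.1 hq with rfl | hq
  · exact ⟨hp, h0⟩
  · exact hL.2 q hq

theorem IsReduced.append {L M : List (ι × A)} (hL : IsReduced φ 𝒜 L) (hM : IsReduced φ 𝒜 M)
    (hne : ∀ p ∈ L.getLast?, ∀ q ∈ M.head?, p.1 ≠ q.1) : IsReduced φ 𝒜 (L ++ M) := by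
  refine ⟨List.isChain_append.2 ⟨hL.1, hM.1, hne⟩, ?_⟩
  intro q hq
  rcases List.mem_append.1 hq with hq | hq
  · exact hL.2 q hq
  · exact hM.2 q hq

theorem reduced_mem_span {P : ι → Prop} {L : List (ι × A)} (hL : IsReduced φ 𝒜 L)
    (hP : ∀ p ∈ L, P p.1) :
    (L.map Prod.snd).prod ∈ Submodule.span ℂ {(1 : A)} ⊔ reducedSpan φ 𝒜 P := by
  rcases eq_or_ne L [] with rfl | hne
  · exact Submodule.mem_sup_left (by simp)
  · exact Submodule.mem_sup_right (Submodule.subset_span ⟨L, hne, hL, hP, rfl⟩)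

/-- A centred letter times a reduced word is a combination of reduced words. -/
theorem centred_mul_reduced_mem {P : ι → Prop} (h1 : φ 1 = 1) {i : ι} (hi : P i) {b : A}
    (hb : b ∈ 𝒜 i) (h0 : φ b = 0) {L : List (ι × A)} (hL : IsReduced φ 𝒜 L)
    (hP : ∀ p ∈ L, P p.1) :
    b * (L.map Prod.snd).prod ∈ Submodule.span ℂ {(1 : A)} ⊔ reducedSpan φ 𝒜 P := by
  match L with
  | [] =>
    simpa using reduced_mem_span (P := P) (L := [(i, b)])
      (IsReduced.cons (by simpa using hL) hb h0 (by simp)) (by simpa using hi)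
  | p :: L =>
    by_cases hip : i = p.1
    · subst hip
      have hbp : b * p.2 ∈ 𝒜 p.1 := mul_mem hb (hL.2 p (by simp)).1
      -- When colours collide, merge the two letters and recentre; the scalar part leaves the
      -- shorter word `L`.
      have e : b * (((p :: L).map Prod.snd).prod) =
          ((((p.1, b * p.2 - φ (b * p.2) • (1 : A)) :: L).map Prod.snd).prod) +
            φ (b * p.2) • (L.map Prod.snd).prod := by
        simp [sub_mul, mul_assoc]
      rw [e]
      refine add_mem (reduced_mem_span (hL.tail.cons ?_ (sub_smul_one_centred h1 _) ?_) ?_)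
        (Submodule.smul_mem _ _ (reduced_mem_span hL.tail ?_))
      · exact sub_mem hbp (Subalgebra.smul_mem _ (one_mem _) _)
      · exact (List.isChain_cons.1 hL.1).1
      · simpa using hP
      · exact fun q hq => hP q (List.mem_cons_of_mem _ hq)
    · refine reduced_mem_span (L := (i, b) :: p :: L) (hL.cons hb h0 ?_) ?_
      · simpa using hip
      · simpa [hi] using hP

theorem mul_mem_reducedSpan {P : ι → Prop} (h1 : φ 1 = 1) {i : ι} (hi : P i) {b x : A}
    (hb : b ∈ 𝒜 i) (hx : x ∈ Submodule.span ℂ {(1 : A)} ⊔ reducedSpan φ 𝒜 P) :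
    b * x ∈ Submodule.span ℂ {(1 : A)} ⊔ reducedSpan φ 𝒜 P := by
  have e : b * x = (b - φ b • (1 : A)) * x + φ b • x := by simp [sub_mul]
  rw [e]
  refine add_mem ?_ (Submodule.smul_mem _ _ hx)
  have hb' : b - φ b • (1 : A) ∈ 𝒜 i := sub_mem hb (Subalgebra.smul_mem _ (one_mem _) _)
  have h0 := sub_smul_one_centred h1 b
  generalize b - φ b • (1 : A) = c at hb' h0
  suffices hle : Submodule.span ℂ {(1 : A)} ⊔ reducedSpan φ 𝒜 P ≤
      (Submodule.span ℂ {(1 : A)} ⊔ reducedSpan φ 𝒜 P).comap (LinearMap.mulLeft ℂ c) from hle hx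
  refine sup_le (Submodule.span_le.2 ?_) (Submodule.span_le.2 ?_)
  · rintro _ rfl
    simpa using centred_mul_reduced_mem h1 hi hb' h0 (L := []) ⟨List.IsChain.nil, by simp⟩ (by simp)
  · rintro _ ⟨L, -, hL, hP, rfl⟩
    exact centred_mul_reduced_mem h1 hi hb' h0 hL hP

theorem adjoin_le_reducedSpan {P : ι → Prop} (h1 : φ 1 = 1) {y : A}
    (hy : y ∈ Algebra.adjoin ℂ (⋃ i ∈ {i | P i}, (𝒜 i : Set A))) :
    y ∈ Submodule.span ℂ {(1 : A)} ⊔ reducedSpan φ 𝒜 P := by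
  -- Stability of the span under left multiplication by `y` is the form that passes to products in
  -- the adjoin induction.
  suffices h : ∀ x ∈ Submodule.span ℂ {(1 : A)} ⊔ reducedSpan φ 𝒜 P,
      y * x ∈ Submodule.span ℂ {(1 : A)} ⊔ reducedSpan φ 𝒜 P by
    simpa using h 1 (Submodule.mem_sup_left (Submodule.mem_span_singleton_self _))
  induction hy using Algebra.adjoin_induction with
  | mem y hy =>
    simp only [Set.mem_ofPred_eq, Set.mem_iUnion, exists_prop] at hy
    obtain ⟨i, hi, hy⟩ := hy
    exact fun x hx => mul_mem_reducedSpan h1 hi hy hx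
  | algebraMap r =>
    intro x hx
    rw [← Algebra.smul_def]
    exact Submodule.smul_mem _ _ hx
  | add y z _ _ hy hz =>
    intro x hx
    rw [add_mul]
    exact add_mem (hy x hx) (hz x hx)
  | mul y z _ _ hy hz =>
    intro x hx
    rw [mul_assoc]
    exact hy _ (hz x hx)

theorem ListFree.reducedHeadSpan_le_ker (h : ListFree φ 𝒜) {P : ι → Prop} :
    reducedHeadSpan φ 𝒜 P ≤ LinearMap.ker (φ : A →ₗ[ℂ] ℂ) := by
  refine Submodule.span_le.2 ?_
  rintro _ ⟨L, hne, hL, -, rfl⟩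
  exact h L hne hL

theorem reducedSpan_le_reducedHeadSpan {P : ι → Prop} :
    reducedSpan φ 𝒜 P ≤ reducedHeadSpan φ 𝒜 P := by
  refine Submodule.span_mono ?_
  rintro _ ⟨L, hne, hL, hP, rfl⟩
  exact ⟨L, hne, hL, fun p hp => hP p (List.mem_of_mem_head? hp), rfl⟩

/-- Since `φ` kills all nonempty reduced words, the scalar component of `y` equals `φ y`. -/
theorem ListFree.centred_mem_reducedSpan (h : ListFree φ 𝒜) {P : ι → Prop} (h1 : φ 1 = 1) {y : A}
    (hy : y ∈ Algebra.adjoin ℂ (⋃ i ∈ {i | P i}, (𝒜 i : Set A))) (h0 : φ y = 0) :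
    y ∈ reducedSpan φ 𝒜 P := by
  obtain ⟨u, hu, v, hv, rfl⟩ := Submodule.mem_sup.1 (adjoin_le_reducedSpan h1 hy)
  obtain ⟨c, rfl⟩ := Submodule.mem_span_singleton.1 hu
  have hv0 : φ v = 0 := h.reducedHeadSpan_le_ker (reducedSpan_le_reducedHeadSpan hv)
  have hc : c = 0 := by simpa [hv0, h1] using h0
  simpa [hc] using hv

/-- Disjoint colour classes keep the concatenation alternating at the seam. Only the head colour of
`z` matters there, so words can be built from the right. -/
theorem mul_mem_reducedHeadSpan {P Q : ι → Prop} (hPQ : ∀ i, P i → ¬ Q i) {y z : A}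
    (hy : y ∈ reducedSpan φ 𝒜 P) (hz : z ∈ reducedHeadSpan φ 𝒜 Q) :
    y * z ∈ reducedHeadSpan φ 𝒜 P := by
  have h := Submodule.mul_mem_mul hy hz
  rw [reducedSpan, reducedHeadSpan, Submodule.span_mul_span] at h
  refine Submodule.span_mono ?_ h
  rintro _ ⟨_, ⟨L, hne, hL, hP, rfl⟩, _, ⟨M, hM', hM, hQ, rfl⟩, rfl⟩
  refine ⟨L ++ M, by simp [hne], hL.append hM ?_, ?_, by simp⟩
  · intro p hp q hq heq
    exact hPQ _ (hP p (List.mem_of_mem_getLast? hp)) (heq ▸ hQ q hq)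
  · intro p hp
    rw [List.head?_append_of_ne_nil _ hne] at hp
    exact hP p (List.mem_of_mem_head? hp)

/-- Associativity of freeness: algebras generated by disjoint groups of free algebras are free. -/
theorem ListFree.group (h : ListFree φ 𝒜) (h1 : φ 1 = 1) (c : ι → κ) :
    ListFree φ fun k => Algebra.adjoin ℂ (⋃ i ∈ {i | c i = k}, (𝒜 i : Set A)) := by
  intro L hne hL
  suffices key : ∀ (L : List (κ × A)) (p : κ × A),
      IsReduced φ (fun k => Algebra.adjoin ℂ (⋃ i ∈ {i | c i = k}, (𝒜 i : Set A))) (p :: L) →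
      ((p :: L).map Prod.snd).prod ∈ reducedHeadSpan φ 𝒜 (fun i => c i = p.1) by
    match L, hne with
    | p :: L, _ => exact h.reducedHeadSpan_le_ker (key L p hL)
  clear hL hne L
  intro L
  induction L with
  | nil =>
    intro p hp
    have := hp.2 p (by simp)
    simpa using reducedSpan_le_reducedHeadSpan (h.centred_mem_reducedSpan h1 this.1 this.2)
  | cons q L ih =>
    intro p hp
    have hp' := hp.2 p (by simp)
    rw [List.map_cons, List.prod_cons]
    refine mul_mem_reducedHeadSpan (Q := fun i => c i = q.1) ?_
      (h.centred_mem_reducedSpan h1 hp'.1 hp'.2) (ih q hp.tail)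
    rintro i hi hi'
    exact (List.isChain_cons_cons.1 hp.1).1 (hi.symm.trans hi')

end Freeness

/-! ### Uniform bounds for mixed moments of free families. -/

section BoundedMoments

/-- A bounded family of complex numbers. -/
def IsBdd {T : Type*} (f : T → ℂ) : Prop := ∃ C : ℝ, ∀ t, ‖f t‖ ≤ C

variable {T : Type*}

theorem IsBdd.const (c : ℂ) : IsBdd fun _ : T => c := ⟨‖c‖, fun _ => le_rfl⟩

theorem IsBdd.add {f g : T → ℂ} (hf : IsBdd f) (hg : IsBdd g) : IsBdd fun t => f t + g t := by
  obtain ⟨C, hC⟩ := hf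
  obtain ⟨D, hD⟩ := hg
  exact ⟨C + D, fun t => (norm_add_le _ _).trans (add_le_add (hC t) (hD t))⟩

theorem IsBdd.mul {f g : T → ℂ} (hf : IsBdd f) (hg : IsBdd g) : IsBdd fun t => f t * g t := by
  obtain ⟨C, hC⟩ := hf
  obtain ⟨D, hD⟩ := hg
  refine ⟨C * D, fun t => (norm_mul _ _).trans_le ?_⟩
  exact mul_le_mul (hC t) (hD t) (norm_nonneg _) ((norm_nonneg _).trans (hC t))

theorem IsBdd.neg {f : T → ℂ} (hf : IsBdd f) : IsBdd fun t => -f t := by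
  simpa [IsBdd] using hf

variable {A : Type*} {κ : Type*}

/-- The total weight of a list of coloured weighted factors. -/
def listWeight (L : List (κ × ℕ × (T → A))) : ℕ := (L.map fun p => p.2.1).sum

theorem listWeight_append (L M : List (κ × ℕ × (T → A))) :
    listWeight (L ++ M) = listWeight L + listWeight M := by simp [listWeight]

theorem listWeight_cons (p : κ × ℕ × (T → A)) (M : List (κ × ℕ × (T → A))) :
    listWeight (p :: M) = p.2.1 + listWeight M := by simp [listWeight]

variable [CStarAlgebra A]

/-- Polynomials with bounded coefficients in a family `z` of elements; a power `z ^ d` has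
weight `w * d`. -/
inductive PowSpan (z : T → A) (w : ℕ) : ℕ → (T → A) → Prop
  | pow {n d : ℕ} (h : w * d ≤ n) : PowSpan z w n fun t => z t ^ d
  | add {n : ℕ} {u v : T → A} : PowSpan z w n u → PowSpan z w n v →
      PowSpan z w n fun t => u t + v t
  | smul {n : ℕ} {f : T → ℂ} {u : T → A} : IsBdd f → PowSpan z w n u →
      PowSpan z w n fun t => f t • u t

/-- Noncommutative polynomials with bounded coefficients in the families `z c`; the letter `z c`
has weight `w c`. -/
inductive WordSpan (z : κ → T → A) (w : κ → ℕ) : ℕ → (T → A) → Prop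
  | one {n : ℕ} : WordSpan z w n fun _ => 1
  | letter {n m : ℕ} {u : T → A} (c : κ) (h : w c + n ≤ m) : WordSpan z w n u →
      WordSpan z w m fun t => z c t * u t
  | add {n : ℕ} {u v : T → A} : WordSpan z w n u → WordSpan z w n v →
      WordSpan z w n fun t => u t + v t
  | smul {n : ℕ} {f : T → ℂ} {u : T → A} : IsBdd f → WordSpan z w n u →
      WordSpan z w n fun t => f t • u t

theorem WordSpan.mono {z : κ → T → A} {w : κ → ℕ} {n m : ℕ} {u : T → A} (h : WordSpan z w n u)
    (hnm : n ≤ m) : WordSpan z w m u := by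
  induction h generalizing m with
  | one => exact .one
  | letter c h hu _ => exact .letter c (h.trans hnm) hu
  | add _ _ ihu ihv => exact (ihu hnm).add (ihv hnm)
  | smul hf _ ih => exact .smul hf (ih hnm)

theorem PowSpan.mul {z : T → A} {w n m : ℕ} {u v : T → A} (hu : PowSpan z w n u)
    (hv : PowSpan z w m v) : PowSpan z w (n + m) fun t => u t * v t := by
  induction hu with
  | pow h =>
    induction hv with
    | pow h' =>
      simp only [← pow_add]
      exact .pow (by rw [mul_add]; omega)
    | add _ _ ihu ihv => simpa only [mul_add] using ihu.add ihv
    | smul hf _ ih => simpa only [mul_smul_comm] using ih.smul hf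
  | add _ _ ihu ihv => simpa only [add_mul] using ihu.add ihv
  | smul hf _ ih => simpa only [smul_mul_assoc] using ih.smul hf

theorem PowSpan.mem {z : T → A} {w n : ℕ} {u : T → A} (hu : PowSpan z w n u) {t : T}
    {S : Subalgebra ℂ A} (hz : z t ∈ S) : u t ∈ S := by
  induction hu with
  | pow h => exact pow_mem hz _
  | add _ _ ihu ihv => exact add_mem ihu ihv
  | smul hf _ ih => exact S.smul_mem ih _

variable {φ : A →L[ℂ] ℂ}

theorem PowSpan.isBdd {z : T → A} {w n D : ℕ} {u : T → A} (hu : PowSpan z w n u) (hn : n ≤ D)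
    (hz : ∀ d, w * d ≤ D → IsBdd fun t => φ (z t ^ d)) : IsBdd fun t => φ (u t) := by
  induction hu with
  | pow h => exact hz _ (h.trans hn)
  | add _ _ ihu ihv => simpa only [map_add] using ihu.add ihv
  | smul hf _ ih => simpa only [map_smul, smul_eq_mul] using hf.mul ih

theorem PowSpan.centre {z : T → A} {w n D : ℕ} {u : T → A} (hu : PowSpan z w n u) (hn : n ≤ D)
    (hz : ∀ d, w * d ≤ D → IsBdd fun t => φ (z t ^ d)) :
    PowSpan z w n fun t => u t - φ (u t) • (1 : A) := by
  have h0 : PowSpan z w n fun _ : T => (1 : A) := by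
    simpa using PowSpan.pow (z := z) (w := w) (n := n) (d := 0) (by simp)
  simpa [sub_eq_add_neg] using hu.add (h0.smul (hu.isBdd hn hz).neg)

/-- The product of a list of coloured weighted factors. -/
noncomputable def listValue (L : List (κ × ℕ × (T → A))) (t : T) : A :=
  (L.map fun p => p.2.2 t).prod

theorem listValue_append (L M : List (κ × ℕ × (T → A))) (t : T) :
    listValue (L ++ M) t = listValue L t * listValue M t := by simp [listValue]

theorem listValue_cons (p : κ × ℕ × (T → A)) (M : List (κ × ℕ × (T → A))) (t : T) :
    listValue (p :: M) t = p.2.2 t * listValue M t := by simp [listValue]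

variable {ℬ : T → κ → Subalgebra ℂ A} {z : κ → T → A} {w : κ → ℕ} {D : ℕ}

/-- The prefix `L` is already centred. Split the next factor as its centring plus a scalar: the
centring joins the prefix, while the scalar drops out and leaves a shorter word, handled by `ih`.
Once everything is centred, freeness gives zero. -/
theorem isBdd_listValue_of_isChain (h1 : φ 1 = 1) (hfree : ∀ t, ListFree φ (ℬ t))
    (hmem : ∀ c t, z c t ∈ ℬ t c)
    (hz : ∀ c d, w c * d ≤ D → IsBdd fun t => φ (z c t ^ d)) {r : ℕ}
    (ih : ∀ L : List (κ × ℕ × (T → A)), L.length < r →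
      (∀ p ∈ L, PowSpan (z p.1) (w p.1) p.2.1 p.2.2) → listWeight L ≤ D →
      IsBdd fun t => φ (listValue L t))
    (M : List (κ × ℕ × (T → A))) : ∀ L : List (κ × ℕ × (T → A)), (L ++ M).length = r →
      (∀ p ∈ L ++ M, PowSpan (z p.1) (w p.1) p.2.1 p.2.2) → listWeight (L ++ M) ≤ D →
      ((L ++ M).map Prod.fst).IsChain (· ≠ ·) → (∀ p ∈ L, ∀ t, φ (p.2.2 t) = 0) →
      IsBdd fun t => φ (listValue (L ++ M) t) := by
  induction M with
  | nil =>
    intro L _ hL _ hchain hcentred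
    rw [List.append_nil] at *
    rcases eq_or_ne L [] with rfl | hne
    · simpa [listValue] using IsBdd.const (T := T) (φ 1)
    · convert! IsBdd.const (T := T) 0 with t
      have := hfree t (L.map fun p => (p.1, p.2.2 t)) (by simpa using hne) ⟨?_, ?_⟩
      · simpa [listValue, Function.comp_def] using this
      · rw [List.isChain_map] at hchain ⊢
        exact hchain
      · intro p hp
        obtain ⟨q, hq, rfl⟩ := List.mem_map.1 hp
        exact ⟨(hL q hq).mem (hmem _ t), hcentred q hq t⟩
  | cons v M ihM =>
    intro L hlen hL hD hchain hcentred
    have hv : PowSpan (z v.1) (w v.1) v.2.1 v.2.2 := hL v (by simp)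
    have hvD : v.2.1 ≤ D := by
      rw [listWeight_append, listWeight_cons] at hD
      omega
    have hb := hv.isBdd hvD (hz v.1)
    have h2 := ihM (L ++ [(v.1, v.2.1, fun t => v.2.2 t - φ (v.2.2 t) • (1 : A))])
      (by simpa using hlen) ?_ (by simpa [listWeight] using hD) (by simpa using hchain) ?_
    · have h3 := ih (L ++ M) (by rw [← hlen]; simp) (fun p hp => hL p ?_) ?_
      · convert! h2.add (hb.mul h3) with t
        simp only [List.append_assoc, List.singleton_append, listValue_append, listValue_cons,
          sub_mul, mul_sub, map_sub, smul_mul_assoc, one_mul, mul_smul_comm, map_smul, smul_eq_mul]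
        ring
      · rcases List.mem_append.1 hp with hp | hp <;> simp [hp]
      · rw [listWeight_append, listWeight_cons] at hD
        rw [listWeight_append]
        omega
    · intro p hp
      simp only [List.append_assoc, List.singleton_append, List.mem_append, List.mem_cons] at hp
      rcases hp with hp | rfl | hp
      · exact hL p (by simp [hp])
      · exact hv.centre hvD (hz v.1)
      · exact hL p (by simp [hp])
    · intro p hp t
      simp only [List.mem_append, List.mem_singleton] at hp
      rcases hp with hp | rfl
      · exact hcentred p hp t
      · exact sub_smul_one_centred h1 _

theorem exists_adjacent_of_not_isChain {α : Type*} {R : α → α → Prop} {L : List α}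
    (h : ¬ L.IsChain R) : ∃ L₁ a b L₂, L = L₁ ++ a :: b :: L₂ ∧ ¬ R a b := by
  induction L with
  | nil => exact absurd List.IsChain.nil h
  | cons a L ih =>
    by_cases hL : L.IsChain R
    · match L with
      | [] => exact absurd (List.IsChain.singleton a) h
      | b :: L =>
        exact ⟨[], a, b, L, rfl, fun hab => h (List.isChain_cons_cons.2 ⟨hab, hL⟩)⟩
    · obtain ⟨L₁, b, c, L₂, rfl, hbc⟩ := ih hL
      exact ⟨a :: L₁, b, c, L₂, rfl, hbc⟩

/-- Mixed moments of free families are bounded in terms of moments of the single families. -/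
theorem isBdd_listValue (h1 : φ 1 = 1) (hfree : ∀ t, ListFree φ (ℬ t))
    (hmem : ∀ c t, z c t ∈ ℬ t c)
    (hz : ∀ c d, w c * d ≤ D → IsBdd fun t => φ (z c t ^ d))
    (L : List (κ × ℕ × (T → A))) (hL : ∀ p ∈ L, PowSpan (z p.1) (w p.1) p.2.1 p.2.2)
    (hD : listWeight L ≤ D) : IsBdd fun t => φ (listValue L t) := by
  induction hr : L.length using Nat.strong_induction_on generalizing L with
  | _ r ih =>
  by_cases hchain : L.IsChain fun p q => p.1 ≠ q.1
  · exact isBdd_listValue_of_isChain h1 hfree hmem hz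
      (fun L hlen hL hD => ih _ hlen L hL hD rfl) L [] hr hL hD
      (by rwa [List.nil_append, List.isChain_map]) (by simp)
  · obtain ⟨L₁, p, q, L₂, rfl, hpq⟩ := exists_adjacent_of_not_isChain hchain
    obtain ⟨c, n, u⟩ := p
    obtain ⟨c', m, v⟩ := q
    obtain rfl : c = c' := not_not.1 hpq
    -- Neighbours of equal colour merge into one factor, which shortens the word and preserves the
    -- total weight.
    have := ih (r - 1) (by rw [← hr]; simp) (L₁ ++ (c, n + m, fun t => u t * v t) :: L₂) ?_ ?_ ?_
    · simpa [listValue, mul_assoc] using this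
    · intro p hp
      simp only [List.mem_append, List.mem_cons] at hp
      rcases hp with hp | rfl | hp
      · exact hL p (by simp [hp])
      · exact (hL (c, n, u) (by simp)).mul (hL (c, m, v) (by simp))
      · exact hL p (by simp [hp])
    · simpa [listWeight, add_assoc] using hD
    · rw [← hr]
      simp

theorem WordSpan.isBdd {n : ℕ} {u : T → A} (hu : WordSpan z w n u) (h1 : φ 1 = 1)
    (hfree : ∀ t, ListFree φ (ℬ t)) (hmem : ∀ c t, z c t ∈ ℬ t c)
    (hz : ∀ c d, w c * d ≤ D → IsBdd fun t => φ (z c t ^ d)) (hn : n ≤ D) :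
    IsBdd fun t => φ (u t) := by
  -- The prefix `L` accumulates the letters peeled off `u` during the induction.
  suffices h : ∀ L : List (κ × ℕ × (T → A)), (∀ p ∈ L, PowSpan (z p.1) (w p.1) p.2.1 p.2.2) →
      listWeight L + n ≤ D → IsBdd fun t => φ (listValue L t * u t) by
    simpa [listValue] using h [] (by simp) (by simpa [listWeight] using hn)
  clear hn
  induction hu with
  | one =>
    intro L hL hD
    simpa using isBdd_listValue h1 hfree hmem hz L hL (by omega)
  | @letter n m u c h hu ih =>
    intro L hL hD
    have := ih (L ++ [(c, w c, z c)]) ?_ (by simp [listWeight] at hD ⊢; omega)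
    · simpa [listValue, mul_assoc] using this
    · intro p hp
      simp only [List.mem_append, List.mem_singleton] at hp
      rcases hp with hp | rfl
      · exact hL p hp
      · simpa using PowSpan.pow (z := z c) (w := w c) (n := w c) (d := 1) (by simp)
  | add _ _ ihu ihv =>
    intro L hL hD
    simpa only [mul_add, map_add] using (ihu L hL hD).add (ihv L hL hD)
  | smul hf _ ih =>
    intro L hL hD
    simpa only [mul_smul_comm, map_smul, smul_eq_mul] using hf.mul (ih L hL hD)

end BoundedMoments

/-! ### Expansion of powers of `y + ε • b` with `b` free from `y`. -/

section Expansion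

variable {A : Type*} [CStarAlgebra A]

/-- The coefficient of `ε` in `(y + ε • b) ^ k`. -/
noncomputable def powLinear (b y : A) : ℕ → A
  | 0 => 0
  | k + 1 => y * powLinear b y k + b * y ^ k

/-- The first order remainder in the expansion of `(y + ε • b) ^ k`. -/
noncomputable def powRemainder₁ (b y : A) (ε : ℂ) : ℕ → A
  | 0 => 0
  | k + 1 => (y + ε • b) * powRemainder₁ b y ε k + b * y ^ k

/-- The second order remainder in the expansion of `(y + ε • b) ^ k`. -/
noncomputable def powRemainder₂ (b y : A) (ε : ℂ) : ℕ → A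
  | 0 => 0
  | k + 1 => b * powLinear b y k + (y + ε • b) * powRemainder₂ b y ε k

theorem add_smul_pow_eq₁ (b y : A) (ε : ℂ) (k : ℕ) :
    (y + ε • b) ^ k = y ^ k + ε • powRemainder₁ b y ε k := by
  induction k with
  | zero => simp [powRemainder₁]
  | succ k ih =>
    rw [pow_succ', ih, powRemainder₁, mul_add, add_mul, pow_succ', smul_add, mul_smul_comm,
      smul_mul_assoc]
    abel

theorem add_smul_pow_eq₂ (b y : A) (ε : ℂ) (k : ℕ) :
    (y + ε • b) ^ k = y ^ k + ε • powLinear b y k + ε ^ 2 • powRemainder₂ b y ε k := by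
  induction k with
  | zero => simp [powRemainder₂, powLinear]
  | succ k ih =>
    rw [pow_succ', ih, powRemainder₂, powLinear, mul_add, mul_add, mul_smul_comm, mul_smul_comm,
      add_mul, add_mul y _ (powLinear b y k), smul_mul_assoc, smul_mul_assoc, pow_succ' y]
    simp only [smul_add, smul_smul, sq]
    abel

theorem powLinear_eq_sum (b y : A) (k : ℕ) :
    powLinear b y k = ∑ j ∈ Finset.range k, y ^ j * b * y ^ (k - 1 - j) := by
  induction k with
  | zero => simp [powLinear]
  | succ k ih =>
    rw [powLinear, ih, Finset.sum_range_succ', Finset.mul_sum]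
    congr 1
    · refine Finset.sum_congr rfl fun j _ => ?_
      rw [pow_succ', ← mul_assoc, ← mul_assoc]
      congr 2
      omega
    · simp

variable {φ : A →L[ℂ] ℂ} {ℬ : Bool → Subalgebra ℂ A}

theorem ListFree.map_mul_eq_zero (hfree : ListFree φ ℬ) (h1 : φ 1 = 1) {b q : A}
    (hb : b ∈ ℬ true) (hb0 : φ b = 0) (hq : q ∈ ℬ false) : φ (b * q) = 0 := by
  have h := hfree [(true, b), (false, q - φ q • (1 : A))] (by simp) ⟨by simp, ?_⟩
  · simpa [mul_sub, hb0] using h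
  · have := sub_mem hq ((ℬ false).smul_mem (one_mem _) (φ q))
    simpa [hb, hb0, h1] using this

/-- Expand the vanishing alternating word in `b`, `p - φ p`, `b`, `q - φ q`; the leftover terms are
evaluated by the word in `b`, `p - φ p`, `b` and by the centred element `b * b - 1` against `q`. -/
theorem ListFree.map_mul_mul_mul (hfree : ListFree φ ℬ) (h1 : φ 1 = 1) {b p q : A}
    (hb : b ∈ ℬ true) (hb0 : φ b = 0) (hb2 : φ (b ^ 2) = 1) (hp : p ∈ ℬ false)
    (hq : q ∈ ℬ false) : φ (b * p * b * q) = φ p * φ q := by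
  have hp' := sub_mem hp ((ℬ false).smul_mem (one_mem _) (φ p))
  have hq' := sub_mem hq ((ℬ false).smul_mem (one_mem _) (φ q))
  have h4 := hfree [(true, b), (false, p - φ p • (1 : A)), (true, b), (false, q - φ q • (1 : A))]
    (by simp) ⟨by simp, by simpa [hb, hb0, h1] using ⟨hp', hq'⟩⟩
  have h3 := hfree [(true, b), (false, p - φ p • (1 : A)), (true, b)]
    (by simp) ⟨by simp, by simpa [hb, hb0, h1] using hp'⟩
  have hbb : b * b - (1 : A) ∈ ℬ true := sub_mem (mul_mem hb hb) (one_mem _)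
  have h2 := hfree.map_mul_eq_zero h1 hbb (by simp [← sq, hb2, h1]) hq
  simp only [List.map_cons, List.map_nil, List.prod_cons, List.prod_nil, mul_one, mul_sub, sub_mul,
    mul_smul_comm, smul_mul_assoc, one_mul, map_sub, map_smul, smul_eq_mul] at h4 h3 h2
  simp only [← sq, hb2, mul_assoc] at h4 h3 h2 ⊢
  rw [← mul_assoc b b q, ← sq] at h4
  linear_combination h4 + φ q * h3 + φ p * h2

theorem ListFree.map_mul_powLinear (hfree : ListFree φ ℬ) (h1 : φ 1 = 1) {b y : A}
    (hb : b ∈ ℬ true) (hb0 : φ b = 0) (hb2 : φ (b ^ 2) = 1) (hy : y ∈ ℬ false) (k : ℕ) :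
    φ (b * powLinear b y k) = ∑ j ∈ Finset.range k, φ (y ^ j) * φ (y ^ (k - 1 - j)) := by
  rw [powLinear_eq_sum, Finset.mul_sum, map_sum]
  refine Finset.sum_congr rfl fun j _ => ?_
  rw [← hfree.map_mul_mul_mul h1 hb hb0 hb2 (pow_mem hy _) (pow_mem hy _)]
  simp [mul_assoc]

theorem ListFree.map_mul_add_pow (hfree : ListFree φ ℬ) (h1 : φ 1 = 1) {b y : A}
    (hb : b ∈ ℬ true) (hb0 : φ b = 0) (hb2 : φ (b ^ 2) = 1) (hy : y ∈ ℬ false) (ε : ℂ) (k : ℕ) :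
    φ (b * (y + ε • b) ^ k) = ε * (∑ j ∈ Finset.range k, φ (y ^ j) * φ (y ^ (k - 1 - j))) +
      ε ^ 2 * φ (b * powRemainder₂ b y ε k) := by
  rw [add_smul_pow_eq₂, mul_add, mul_add, map_add, map_add,
    hfree.map_mul_eq_zero h1 hb hb0 (pow_mem hy k), zero_add, mul_smul_comm, map_smul,
    hfree.map_mul_powLinear h1 hb hb0 hb2 hy, mul_smul_comm, map_smul, smul_eq_mul, smul_eq_mul]

variable {T : Type*} {z : Bool → T → A}

/-- The weight on `Bool`-coloured letters that counts the colour `false` only. -/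
def falseWeight (c : Bool) : ℕ := if c then 0 else 1

theorem WordSpan.true_mul {n : ℕ} {u : T → A} (hu : WordSpan z falseWeight n u) :
    WordSpan z falseWeight n fun t => z true t * u t :=
  hu.letter true (by simp [falseWeight])

theorem WordSpan.false_mul {n : ℕ} {u : T → A} (hu : WordSpan z falseWeight n u) :
    WordSpan z falseWeight (n + 1) fun t => z false t * u t :=
  hu.letter false (by simp [falseWeight, add_comm])

theorem WordSpan.zero {w : Bool → ℕ} {n : ℕ} : WordSpan z w n fun _ => 0 := by
  simpa using WordSpan.smul (IsBdd.const 0) (WordSpan.one (z := z) (w := w) (n := n))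

theorem WordSpan.false_pow (k : ℕ) : WordSpan z falseWeight k fun t => z false t ^ k := by
  induction k with
  | zero => simpa using WordSpan.one
  | succ k ih => simpa only [pow_succ'] using ih.false_mul

theorem WordSpan.add_smul_mul {ε : T → ℂ} (hε : IsBdd ε) {n : ℕ} {u : T → A}
    (hu : WordSpan z falseWeight n u) :
    WordSpan z falseWeight (n + 1) fun t => (z false t + ε t • z true t) * u t := by
  simpa only [add_mul, smul_mul_assoc] using
    hu.false_mul.add ((hu.true_mul.smul hε).mono (Nat.le_succ n))

theorem wordSpan_powLinear (k : ℕ) :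
    WordSpan z falseWeight k fun t => powLinear (z true t) (z false t) k := by
  induction k with
  | zero => exact .zero
  | succ k ih => exact ih.false_mul.add ((WordSpan.false_pow k).true_mul.mono (Nat.le_succ k))

theorem wordSpan_powRemainder₁ {ε : T → ℂ} (hε : IsBdd ε) (k : ℕ) :
    WordSpan z falseWeight k fun t => powRemainder₁ (z true t) (z false t) (ε t) k := by
  induction k with
  | zero => exact .zero
  | succ k ih =>
    exact (ih.add_smul_mul hε).add ((WordSpan.false_pow k).true_mul.mono (Nat.le_succ k))

/-- Letters `b` are free of charge, so the weight is just the degree in `y`, at most `k`. -/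
theorem wordSpan_powRemainder₂ {ε : T → ℂ} (hε : IsBdd ε) (k : ℕ) :
    WordSpan z falseWeight k fun t => powRemainder₂ (z true t) (z false t) (ε t) k := by
  induction k with
  | zero => exact .zero
  | succ k ih =>
    exact ((wordSpan_powLinear k).true_mul.mono (Nat.le_succ k)).add (ih.add_smul_mul hε)

end Expansion

/-! ### Moments of the semicircle law and a model of a semicircular element. -/

section SemicircleMoments

open MeasureTheory

theorem integral_semicircleLaw {E : Type*} [NormedAddCommGroup E] [NormedSpace ℝ E] (f : ℝ → E) :
    ∫ x, f x ∂(semicircleLaw : Measure ℝ) = ∫ x, semicircleDensity x • f x := by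
  have hm : Measurable fun x => ENNReal.ofReal (semicircleDensity x) :=
    continuous_semicircleDensity.measurable.ennreal_ofReal
  rw [semicircleLaw, ProbabilityMeasure.coe_mk,
    integral_withDensity_eq_integral_toReal_smul hm (by simp)]
  simp [ENNReal.toReal_ofReal (semicircleDensity_nonneg _)]

theorem ae_semicircleLaw_mem_Icc :
    ∀ᵐ x ∂(semicircleLaw : Measure ℝ), x ∈ Set.Icc (-2 : ℝ) 2 := by
  have hm : Measurable fun x => ENNReal.ofReal (semicircleDensity x) :=
    continuous_semicircleDensity.measurable.ennreal_ofReal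
  rw [semicircleLaw, ProbabilityMeasure.coe_mk, ae_withDensity_iff hm]
  refine Filter.Eventually.of_forall fun x hx => ?_
  by_contra h
  exact hx (by rw [semicircleDensity_eq_zero fun h' => h (Set.Ioc_subset_Icc_self h'),
    ENNReal.ofReal_zero])

theorem integrable_pow_semicircleLaw (n : ℕ) :
    Integrable (fun x : ℝ => x ^ n) (semicircleLaw : Measure ℝ) := by
  refine Integrable.of_bound (by fun_prop) ((2 : ℝ) ^ n) ?_
  filter_upwards [ae_semicircleLaw_mem_Icc] with x hx
  rw [norm_pow]
  exact pow_le_pow_left₀ (norm_nonneg _) (abs_le.2 hx) n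

/-- The moments of the semicircle law. -/
noncomputable def semicircleMoment (n : ℕ) : ℝ := ∫ x, x ^ n ∂(semicircleLaw : Measure ℝ)

/-- Substitute `x = 2 cos θ`: the density and the Jacobian each contribute a sine, and `sin² = 1 -
cos²`. -/
theorem semicircleMoment_eq_integral_cos (n : ℕ) :
    semicircleMoment n = 2 / Real.pi * 2 ^ n *
      ((∫ x in (0 : ℝ)..Real.pi, Real.cos x ^ n) -
        ∫ x in (0 : ℝ)..Real.pi, Real.cos x ^ (n + 2)) := by
  rw [semicircleMoment, integral_semicircleLaw,
    ← setIntegral_eq_integral_of_forall_compl_eq_zero (s := Set.Ioc (-2 : ℝ) 2)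
      (fun x hx => by rw [semicircleDensity_eq_zero hx, zero_smul]),
    ← intervalIntegral.integral_of_le (by norm_num : (-2 : ℝ) ≤ 2)]
  have h := intervalIntegral.integral_comp_mul_deriv (a := 0) (b := Real.pi)
    (f := fun x => 2 * Real.cos x) (f' := fun x => 2 * (-Real.sin x))
    (g := fun x => semicircleDensity x • x ^ n)
    (fun x _ => (Real.hasDerivAt_cos x).const_mul 2) (by fun_prop)
    (continuous_semicircleDensity.smul (by fun_prop))
  simp only [Real.cos_zero, Real.cos_pi, mul_one, mul_neg] at h
  rw [intervalIntegral.integral_symm, ← h, ← intervalIntegral.integral_sub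
    (Continuous.intervalIntegrable (by fun_prop) _ _)
    (Continuous.intervalIntegrable (by fun_prop) _ _), ← intervalIntegral.integral_neg,
    ← intervalIntegral.integral_const_mul]
  refine intervalIntegral.integral_congr fun x hx => ?_
  rw [Set.uIcc_of_le Real.pi_pos.le] at hx
  have hs := Real.sin_nonneg_of_mem_Icc hx
  have h4 : (4 : ℝ) - (2 * Real.cos x) ^ 2 = (2 * Real.sin x) ^ 2 := by
    have := Real.sin_sq_add_cos_sq x
    linear_combination -4 * this
  simp only [Function.comp_apply, smul_eq_mul, semicircleDensity]
  rw [h4, max_eq_left (by positivity), Real.sqrt_sq (by positivity)]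
  have h5 : Real.cos x ^ (n + 2) = Real.cos x ^ n * (1 - Real.sin x ^ 2) := by
    rw [← Real.cos_sq', pow_add]
  rw [h5, mul_pow]
  field_simp
  ring

theorem integral_cos_pow_zero_pi (n : ℕ) : ∫ x in (0 : ℝ)..Real.pi, Real.cos x ^ (n + 2) =
    (n + 1) / (n + 2) * ∫ x in (0 : ℝ)..Real.pi, Real.cos x ^ n := by
  rw [integral_cos_pow]
  simp

theorem semicircleMoment_add_two (n : ℕ) :
    semicircleMoment (n + 2) = 4 * (n + 1) / (n + 4) * semicircleMoment n := by
  rw [semicircleMoment_eq_integral_cos, semicircleMoment_eq_integral_cos,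
    integral_cos_pow_zero_pi (n + 2), integral_cos_pow_zero_pi n]
  push_cast
  field_simp
  ring

theorem semicircleMoment_zero : semicircleMoment 0 = 1 := by simp [semicircleMoment]

theorem semicircleMoment_one : semicircleMoment 1 = 0 := by
  rw [semicircleMoment_eq_integral_cos, integral_cos_pow_zero_pi 1]
  simp

theorem semicircleMoment_odd (n : ℕ) : semicircleMoment (2 * n + 1) = 0 := by
  induction n with
  | zero => exact semicircleMoment_one
  | succ n ih => rw [show 2 * (n + 1) + 1 = 2 * n + 1 + 2 by ring, semicircleMoment_add_two, ih,
      mul_zero]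

/-- Both sequences have successive ratio `2(2n+1)/(n+2)`; for Catalan numbers it comes from the
central binomials. -/
theorem semicircleMoment_even (n : ℕ) : semicircleMoment (2 * n) = catalan n := by
  induction n with
  | zero => simpa using semicircleMoment_zero
  | succ n ih =>
    rw [mul_add, mul_one, semicircleMoment_add_two, ih]
    have h1 := succ_mul_catalan_eq_centralBinom n
    have h2 := succ_mul_catalan_eq_centralBinom (n + 1)
    have h3 := Nat.succ_mul_centralBinom_succ n
    rw [← h1, ← h2] at h3
    have h4 : ((n : ℝ) + 1) * ((n + 2) * catalan (n + 1)) =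
        2 * (2 * n + 1) * ((n + 1) * catalan n) := by exact_mod_cast h3
    have h5 : ((n : ℝ) + 2) * catalan (n + 1) = 2 * (2 * n + 1) * catalan n := by
      apply mul_left_cancel₀ (by positivity : (n : ℝ) + 1 ≠ 0)
      linear_combination h4
    have h6 : (catalan (n + 1) : ℝ) = 2 * (2 * n + 1) * catalan n / (n + 2) := by
      rw [← h5]
      field_simp
    rw [h6]
    push_cast
    field_simp
    ring

theorem semicircleMoment_succ (k : ℕ) : semicircleMoment (k + 1) =
    ∑ j ∈ Finset.range k, semicircleMoment j * semicircleMoment (k - 1 - j) := by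
  obtain ⟨n, rfl | rfl⟩ := Nat.even_or_odd' k
  · rw [semicircleMoment_odd]
    refine (Finset.sum_eq_zero fun j hj => ?_).symm
    rw [Finset.mem_range] at hj
    obtain ⟨i, rfl | rfl⟩ := Nat.even_or_odd' j
    · rw [show 2 * n - 1 - 2 * i = 2 * (n - 1 - i) + 1 by omega, semicircleMoment_odd, mul_zero]
    · rw [semicircleMoment_odd, zero_mul]
  · rw [show 2 * n + 1 + 1 = 2 * (n + 1) by ring, semicircleMoment_even, catalan_succ',
      Finset.Nat.sum_antidiagonal_eq_sum_range_succ fun i j => catalan i * catalan j]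
    -- Odd `j` contribute nothing, so the sum collapses to the Catalan convolution over `j = 2 * i`.
    have h : ∀ m : ℕ, m ≤ n → ∑ j ∈ Finset.range (2 * m + 1),
        semicircleMoment j * semicircleMoment (2 * n + 1 - 1 - j) =
        ∑ i ∈ Finset.range (m + 1), (catalan i : ℝ) * catalan (n - i) := by
      intro m hm
      induction m with
      | zero => simp [semicircleMoment_zero, semicircleMoment_even]
      | succ m ih =>
        rw [show 2 * (m + 1) + 1 = 2 * m + 1 + 1 + 1 by ring, Finset.sum_range_succ,
          Finset.sum_range_succ, ih (by omega), semicircleMoment_odd, zero_mul, add_zero,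
          Finset.sum_range_succ _ (m + 1), show 2 * m + 1 + 1 = 2 * (m + 1) by ring,
          show 2 * n + 1 - 1 - 2 * (m + 1) = 2 * (n - (m + 1)) by omega, semicircleMoment_even,
          semicircleMoment_even]
    rw [h n le_rfl]
    push_cast
    rfl

theorem semicircleMoment_two_mul_le (n : ℕ) : semicircleMoment (2 * n) ≤ 2 ^ (2 * n) := by
  have h : ∫ _x : ℝ, (2 : ℝ) ^ (2 * n) ∂(semicircleLaw : Measure ℝ) = 2 ^ (2 * n) := by simp
  rw [← h]
  refine integral_mono_ae (integrable_pow_semicircleLaw _) (integrable_const _) ?_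
  filter_upwards [ae_semicircleLaw_mem_Icc] with x hx
  rw [← (even_two_mul n).pow_abs]
  exact pow_le_pow_left₀ (abs_nonneg _) (abs_le.2 hx) _

/-- Integration against the semicircle law, as a functional on `C([-2, 2])`. -/
noncomputable def semicircleState : C(Set.Icc (-2 : ℝ) 2, ℂ) →L[ℂ] ℂ :=
  LinearMap.mkContinuous
    { toFun := fun f => ∫ x, f (Set.projIcc (-2) 2 (by norm_num) x) ∂(semicircleLaw : Measure ℝ)
      map_add' := fun f g => by
        simp only [ContinuousMap.add_apply]
        refine integral_add ?_ ?_ <;>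
        exact Integrable.of_bound (by fun_prop) _
          (Filter.Eventually.of_forall fun x => ContinuousMap.norm_coe_le_norm _ _)
      map_smul' := fun c f => by
        simp [integral_const_mul] } 1
    (fun f => by
      refine (norm_integral_le_of_norm_le_const
        (Filter.Eventually.of_forall fun x => f.norm_coe_le_norm _)).trans ?_
      simp)

theorem semicircleState_apply (f : C(Set.Icc (-2 : ℝ) 2, ℂ)) : semicircleState f =
    ∫ x, f (Set.projIcc (-2) 2 (by norm_num) x) ∂(semicircleLaw : Measure ℝ) := rfl

theorem isState_semicircleState : IsState semicircleState := by
  refine ⟨fun f => ?_, le_antisymm (LinearMap.mkContinuous_norm_le _ zero_le_one _) ?_⟩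
  · rw [semicircleState_apply]
    have h : ∀ y, (star f * f) y = ((‖f y‖ ^ 2 : ℝ) : ℂ) := fun y => by
      simp [← Complex.conj_mul']
    simp only [h]
    rw [integral_complex_ofReal, Complex.zero_le_real]
    exact integral_nonneg fun x => by positivity
  · have h := semicircleState.le_opNorm 1
    have hone : ‖(1 : C(Set.Icc (-2 : ℝ) 2, ℂ))‖ ≤ 1 :=
      (ContinuousMap.norm_le _ zero_le_one).2 fun x => by simp
    rw [semicircleState_apply] at h
    simp only [ContinuousMap.one_apply, integral_const, probReal_univ, one_smul, norm_one] at h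
    exact h.trans (mul_le_of_le_one_right (norm_nonneg _) hone)

/-- The coordinate function on `[-2, 2]`. -/
noncomputable def semicircleElement : C(Set.Icc (-2 : ℝ) 2, ℂ) :=
  ⟨fun x => ((x : ℝ) : ℂ), by fun_prop⟩

theorem isSemicircular_semicircleElement : IsSemicircular semicircleState semicircleElement := by
  refine ⟨?_, fun n => ⟨integrable_pow_semicircleLaw n, ?_⟩⟩
  · ext x
    simp [semicircleElement]
  · rw [semicircleState_apply, ← integral_complex_ofReal]
    refine integral_congr_ae ?_
    filter_upwards [ae_semicircleLaw_mem_Icc] with x hx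
    rw [Set.projIcc_of_mem _ hx]
    simp [semicircleElement]

end SemicircleMoments

/-! ### Laws of self-adjoint elements. -/

section ExistenceOfLaw

open MeasureTheory
variable {A : Type*} [CStarAlgebra A]

/-- Composing `φ` with the continuous functional calculus gives a positive functional on functions
on the spectrum; its Riesz measure, pushed to the line, is the law. -/
theorem exists_isLaw_of_isSelfAdjoint {φ : A →L[ℂ] ℂ} (hφ : IsState φ) (h1 : φ 1 = 1) {a : A}
    (ha : IsSelfAdjoint a) : ∃ μ : ProbabilityMeasure ℝ, IsLaw φ a μ := by
  let Φ : C(spectrum ℝ a, ℝ) →⋆ₐ[ℝ] A := cfcHom ha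
  have hpos : ∀ f : C(spectrum ℝ a, ℝ), 0 ≤ f → ∃ r : ℝ, 0 ≤ r ∧ φ (Φ f) = r := by
    intro f hf
    let g : C(spectrum ℝ a, ℝ) := ⟨fun x => Real.sqrt (f x), by fun_prop⟩
    have hg : f = star g * g := by
      ext x
      simpa [g] using (Real.mul_self_sqrt (hf x)).symm
    have h := hφ.1 (Φ g)
    rw [← map_star, ← map_mul, ← hg, Complex.nonneg_iff] at h
    exact ⟨(φ (Φ f)).re, h.1, Complex.ext (by simp) (by simpa using h.2.symm)⟩
  let Λ : CompactlySupportedContinuousMap (spectrum ℝ a) ℝ →ₚ[ℝ] ℝ :=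
    PositiveLinearMap.mk₀
      { toFun := fun f => (φ (Φ f.toContinuousMap)).re
        map_add' := fun f g => by
          have : (f + g).toContinuousMap = f.toContinuousMap + g.toContinuousMap := rfl
          simp [this]
        map_smul' := fun c f => by
          have : (c • f).toContinuousMap = c • f.toContinuousMap := rfl
          rw [this, map_smul, ← Complex.coe_smul, map_smul]
          simp }
      (fun f hf => by
        obtain ⟨r, hr, hfr⟩ := hpos f.toContinuousMap hf
        change 0 ≤ (φ (Φ f.toContinuousMap)).re
        simpa [hfr] using hr)
  let m : Measure (spectrum ℝ a) := RealRMK.rieszMeasure Λ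
  have hm : ∀ f : C(spectrum ℝ a, ℝ), ∫ x, f x ∂m = (φ (Φ f)).re := fun f =>
    RealRMK.integral_rieszMeasure Λ ⟨f, HasCompactSupport.of_compactSpace f⟩
  have hreal : ∀ f : C(spectrum ℝ a, ℝ), (((φ (Φ f)).re : ℝ) : ℂ) = φ (Φ f) := by
    intro f
    -- Adding `‖f‖` makes `f` nonnegative and changes the value of `φ` by a real number only.
    obtain ⟨r, -, hr⟩ := hpos (f + ContinuousMap.const _ ‖f‖) (fun x => by
      have := f.norm_coe_le_norm x
      change 0 ≤ f x + ‖f‖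
      rw [Real.norm_eq_abs] at this
      linarith [neg_abs_le (f x)])
    have hc : ContinuousMap.const (spectrum ℝ a) ‖f‖ = algebraMap ℝ C(spectrum ℝ a, ℝ) ‖f‖ := rfl
    rw [hc, map_add, AlgHomClass.commutes, Algebra.algebraMap_eq_smul_one, ← Complex.coe_smul,
      map_add, map_smul, h1] at hr
    have him := congrArg Complex.im hr
    simp at him
    exact Complex.ext (by simp) (by simp [him])
  have hprob : IsProbabilityMeasure m := by
    have h := hm 1
    simp only [ContinuousMap.one_apply, map_one, h1, Complex.one_re, integral_const, smul_eq_mul,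
      mul_one] at h
    have h' : m.real Set.univ ≠ 0 := by rw [h]; norm_num
    refine ⟨?_⟩
    rw [Measure.real, ENNReal.toReal_eq_one_iff] at h
    exact h
  let ι : spectrum ℝ a → ℝ := Subtype.val
  have hι : Measurable ι := measurable_subtype_coe
  refine ⟨⟨m.map ι, Measure.isProbabilityMeasure_map hι.aemeasurable⟩, fun n => ?_⟩
  let g : C(spectrum ℝ a, ℝ) := ((ContinuousMap.id ℝ).restrict (spectrum ℝ a)) ^ n
  have hint : Integrable (fun x => g x) m :=
    g.continuous.integrable_of_hasCompactSupport (HasCompactSupport.of_compactSpace _)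
  refine ⟨?_, ?_⟩
  · rw [ProbabilityMeasure.coe_mk, integrable_map_measure (by fun_prop) hι.aemeasurable]
    exact hint
  · rw [ProbabilityMeasure.coe_mk, integral_map hι.aemeasurable (by fun_prop)]
    have h := hm g
    have hg : Φ g = a ^ n := by
      simp only [g, map_pow, Φ]
      rw [cfcHom_id ha]
    have : ∫ x, ι x ^ n ∂m = ∫ x, g x ∂m := rfl
    rw [this, h, hreal, hg]

end ExistenceOfLaw

/-! ### From convergence of moments to weak convergence. -/

section MomentMethod

open MeasureTheory Filter Topology
open scoped BoundedContinuousFunction Polynomial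

theorem integrable_eval {ν : Measure ℝ} (hν : ∀ n : ℕ, Integrable (fun x : ℝ => x ^ n) ν)
    (p : ℝ[X]) : Integrable (fun x => p.eval x) ν := by
  simp only [Polynomial.eval_eq_sum_range]
  exact integrable_finsetSum _ fun i _ => (hν i).const_mul _

theorem tendsto_integral_eval {ν : ℕ → Measure ℝ} {ν' : Measure ℝ}
    (hν : ∀ N, ∀ n : ℕ, Integrable (fun x : ℝ => x ^ n) (ν N))
    (hν' : ∀ n : ℕ, Integrable (fun x : ℝ => x ^ n) ν')
    (h : ∀ n : ℕ, Tendsto (fun N => ∫ x, x ^ n ∂ν N) atTop (𝓝 (∫ x, x ^ n ∂ν'))) (p : ℝ[X]) :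
    Tendsto (fun N => ∫ x, p.eval x ∂ν N) atTop (𝓝 (∫ x, p.eval x ∂ν')) := by
  simp only [Polynomial.eval_eq_sum_range]
  rw [integral_finsetSum _ fun i _ => (hν' i).const_mul _]
  simp only [fun N => integral_finsetSum (μ := ν N) (Finset.range (p.natDegree + 1))
    fun i _ => (hν N i).const_mul (p.coeff i), integral_const_mul]
  exact tendsto_finsetSum _ fun i _ => (h i).const_mul _

theorem abs_eval_le_pow (p : ℝ[X]) : ∃ C : ℝ, 0 ≤ C ∧ ∃ e : ℕ, ∀ x : ℝ, 1 ≤ |x| →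
    |p.eval x| ≤ C * x ^ (2 * e) := by
  refine ⟨∑ i ∈ Finset.range (p.natDegree + 1), |p.coeff i|,
    Finset.sum_nonneg fun i _ => abs_nonneg _, p.natDegree, fun x hx => ?_⟩
  rw [Polynomial.eval_eq_sum_range, Finset.sum_mul]
  refine (Finset.abs_sum_le_sum_abs _ _).trans (Finset.sum_le_sum fun i hi => ?_)
  rw [abs_mul, abs_pow, ← (even_two_mul p.natDegree).pow_abs]
  rw [Finset.mem_range] at hi
  exact mul_le_mul_of_nonneg_left (pow_le_pow_right₀ hx (by omega)) (abs_nonneg _)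

/-- Weierstrass gives `p` close to `f` on `[-(R+1), R+1]`. Outside, the error is at most `(‖f‖ + C)
x^(2e)`, hence also at most this times `(x/(R+1))^(2m)`. The moment bound makes the integral of that
monomial decay like `(R/(R+1))^(2m)`, so a large `m` suffices. -/
theorem exists_polynomial_majorant {ν : ProbabilityMeasure ℝ} {R : ℝ} (hR : 0 ≤ R)
    (hν : ∀ n : ℕ, Integrable (fun x : ℝ => x ^ n) (ν : Measure ℝ))
    (hmom : ∀ n : ℕ, ∫ x, x ^ (2 * n) ∂(ν : Measure ℝ) ≤ R ^ (2 * n)) (f : ℝ →ᵇ ℝ) {ε : ℝ}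
    (hε : 0 < ε) : ∃ p q : ℝ[X], (∀ x, |f x - p.eval x| ≤ q.eval x) ∧
      ∫ x, q.eval x ∂(ν : Measure ℝ) < ε := by
  obtain ⟨p, hp⟩ := exists_polynomial_near_of_continuousOn (-(R + 1)) (R + 1) f
    f.continuous.continuousOn (ε / 2) (by positivity)
  obtain ⟨C, hC, e, hCe⟩ := abs_eval_le_pow p
  have hlim : Tendsto (fun m : ℕ => (‖f‖ + C) * R ^ (2 * e) * ((R / (R + 1)) ^ 2) ^ m) atTop
      (𝓝 ((‖f‖ + C) * R ^ (2 * e) * 0)) := by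
    refine (tendsto_pow_atTop_nhds_zero_of_lt_one (by positivity) ?_).const_mul _
    have : R / (R + 1) < 1 := by
      rw [div_lt_one (by positivity)]
      linarith
    exact pow_lt_one₀ (by positivity) this two_ne_zero
  rw [mul_zero] at hlim
  obtain ⟨m, hm⟩ := (hlim.eventually_lt_const (half_pos hε)).exists
  set c : ℝ := (‖f‖ + C) / (R + 1) ^ (2 * m) with hc
  have hc0 : 0 ≤ c := by positivity
  refine ⟨p, Polynomial.C (ε / 2) + Polynomial.C c * Polynomial.X ^ (2 * (e + m)), ?_, ?_⟩
  · intro x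
    simp only [Polynomial.eval_add, Polynomial.eval_C, Polynomial.eval_mul, Polynomial.eval_pow,
      Polynomial.eval_X]
    have hev : ∀ k : ℕ, 0 ≤ x ^ (2 * k) := fun k => (even_two_mul k).pow_nonneg x
    by_cases hx : x ∈ Set.Icc (-(R + 1)) (R + 1)
    · have := hp x hx
      rw [abs_sub_comm] at this
      have := mul_nonneg hc0 (hev (e + m))
      linarith
    · have hx1 : R + 1 < |x| := by
        by_contra h
        exact hx (abs_le.1 (not_lt.1 h))
      have h1 : 1 ≤ |x| := by linarith
      have h2 : |f x| ≤ ‖f‖ * x ^ (2 * e) := by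
        have : 1 ≤ x ^ (2 * e) := by
          rw [← (even_two_mul e).pow_abs]
          exact one_le_pow₀ h1
        exact (f.norm_coe_le_norm x).trans (le_mul_of_one_le_right (norm_nonneg _) this)
      have h3 : (R + 1) ^ (2 * m) ≤ x ^ (2 * m) := by
        rw [← (even_two_mul m).pow_abs x]
        exact pow_le_pow_left₀ (by positivity) hx1.le _
      calc |f x - p.eval x| ≤ |f x| + |p.eval x| := abs_sub _ _
        _ ≤ (‖f‖ + C) * x ^ (2 * e) * 1 := by linarith [hCe x h1]
        _ ≤ (‖f‖ + C) * x ^ (2 * e) * (x ^ (2 * m) / (R + 1) ^ (2 * m)) := by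
          have := hev e
          refine mul_le_mul_of_nonneg_left ?_ (by positivity)
          rwa [one_le_div (by positivity)]
        _ = c * x ^ (2 * (e + m)) := by
          rw [hc, mul_add, pow_add]
          ring
        _ ≤ _ := by linarith
  · simp only [Polynomial.eval_add, Polynomial.eval_C, Polynomial.eval_mul, Polynomial.eval_pow,
      Polynomial.eval_X]
    rw [integral_add (integrable_const _) ((hν _).const_mul _), integral_const_mul]
    have h1 := mul_le_mul_of_nonneg_left (hmom (e + m)) hc0
    have h2 : c * R ^ (2 * (e + m)) =
        (‖f‖ + C) * R ^ (2 * e) * ((R / (R + 1)) ^ 2) ^ m := by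
      rw [hc, mul_add, pow_add, ← pow_mul, div_pow]
      ring
    simp only [integral_const, probReal_univ, smul_eq_mul, one_mul]
    linarith

/-- Convergence of moments to those of a compactly supported law implies weak convergence. -/
theorem tendsto_of_tendsto_moments {ν : ℕ → ProbabilityMeasure ℝ} {ν' : ProbabilityMeasure ℝ}
    {R : ℝ} (hR : 0 ≤ R)
    (hν : ∀ N, ∀ n : ℕ, Integrable (fun x : ℝ => x ^ n) (ν N : Measure ℝ))
    (hν' : ∀ n : ℕ, Integrable (fun x : ℝ => x ^ n) (ν' : Measure ℝ))
    (hmom : ∀ n : ℕ, ∫ x, x ^ (2 * n) ∂(ν' : Measure ℝ) ≤ R ^ (2 * n))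
    (h : ∀ n : ℕ, Tendsto (fun N => ∫ x, x ^ n ∂(ν N : Measure ℝ)) atTop
      (𝓝 (∫ x, x ^ n ∂(ν' : Measure ℝ)))) : Tendsto ν atTop (𝓝 ν') := by
  rw [ProbabilityMeasure.tendsto_iff_forall_integral_tendsto]
  intro f
  rw [Metric.tendsto_nhds]
  intro ε hε
  -- A quarter of `ε` each for replacing `f` by `p` under `ν N`, for the same under `ν'`, and for
  -- the convergence of `∫ p`. The first works because `∫ q` converges too.
  obtain ⟨p, q, hpq, hq⟩ := exists_polynomial_majorant hR hν' hmom f (half_pos (half_pos hε))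
  have key : ∀ m : ProbabilityMeasure ℝ,
      (∀ n : ℕ, Integrable (fun x : ℝ => x ^ n) (m : Measure ℝ)) →
      |∫ x, f x ∂(m : Measure ℝ) - ∫ x, p.eval x ∂(m : Measure ℝ)| ≤
        ∫ x, q.eval x ∂(m : Measure ℝ) := by
    intro m hm
    have hf : Integrable f (m : Measure ℝ) := f.integrable _
    rw [← integral_sub hf (integrable_eval hm p)]
    exact (norm_integral_le_integral_norm _).trans (integral_mono
      (hf.sub (integrable_eval hm p)).norm (integrable_eval hm q) hpq)
  have hp := Metric.tendsto_nhds.1 (tendsto_integral_eval hν hν' h p) (ε / 4) (by positivity)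
  have hq' := (tendsto_integral_eval hν hν' h q).eventually_lt_const hq
  filter_upwards [hp, hq'] with N hN1 hN2
  rw [Real.dist_eq] at *
  have h1 := abs_le.1 (key (ν N) (hν N))
  have h2 := abs_le.1 (key ν' hν')
  have h3 := abs_lt.1 hN1
  rw [abs_lt]
  constructor <;> linarith

end MomentMethod

/-! ### The moment recursion for normalized sums and its limit. -/

section CentralLimit

open MeasureTheory Filter Topology

/-- The normalization `1 / √N` as a complex number. -/
noncomputable def normalization (N : ℕ) : ℂ := ((1 / Real.sqrt N : ℝ) : ℂ)

theorem norm_normalization_le_one (N : ℕ) : ‖normalization N‖ ≤ 1 := by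
  rw [normalization, Complex.norm_real, Real.norm_of_nonneg (by positivity)]
  rcases Nat.eq_zero_or_pos N with rfl | hN
  · simp
  · rw [div_le_one (by positivity), Real.one_le_sqrt]
    exact_mod_cast hN

theorem normalization_sq (N : ℕ) : normalization N ^ 2 = ((1 / N : ℝ) : ℂ) := by
  rw [normalization, ← Complex.ofReal_pow, div_pow, one_pow, Real.sq_sqrt (Nat.cast_nonneg N)]

theorem card_mul_norm_normalization_sq_le {n N : ℕ} (h : n ≤ N) :
    n * ‖normalization N‖ ^ 2 ≤ 1 := by
  rw [← norm_pow, normalization_sq, Complex.norm_real, Real.norm_of_nonneg (by positivity),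
    mul_one_div]
  exact div_le_one_of_le₀ (by exact_mod_cast h) (Nat.cast_nonneg N)

theorem mul_normalization_sq {N : ℕ} (h : N ≠ 0) : (N : ℂ) * normalization N ^ 2 = 1 := by
  rw [normalization_sq]
  push_cast
  field_simp

theorem tendsto_normalization : Tendsto (fun N => ‖normalization N‖) atTop (𝓝 0) := by
  have h : Tendsto (fun N : ℕ => 1 / Real.sqrt N) atTop (𝓝 0) := by
    simpa only [one_div, Function.comp_def] using
      tendsto_inv_atTop_zero.comp (Real.tendsto_sqrt_atTop.comp tendsto_natCast_atTop_atTop)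
  simpa [normalization, abs_of_nonneg] using h

variable {A : Type*} [CStarAlgebra A]

/-- The sum of the `a i` over a finite set, divided by `√N`. -/
noncomputable def normalizedSum (a : ℕ → A) (N : ℕ) (F : Finset ℕ) : A :=
  normalization N • ∑ i ∈ F, a i

theorem normalizedSum_eq_erase (a : ℕ → A) (N : ℕ) {F : Finset ℕ} {i : ℕ} (hi : i ∈ F) :
    normalizedSum a N F = normalizedSum a N (F.erase i) + normalization N • a i := by
  rw [normalizedSum, normalizedSum, ← smul_add, Finset.sum_erase_add _ _ hi]

/-- A choice of `N`, of at most `N` indices, and of one index among them. -/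
abbrev SumIndex : Type := {p : ℕ × Finset ℕ × ℕ // p.2.2 ∈ p.2.1 ∧ p.2.1.card ≤ p.1}

/-- The selected element (`true`) and the normalized sum of the other ones (`false`). -/
noncomputable def sumLetter (a : ℕ → A) (c : Bool) (t : SumIndex) : A :=
  if c then a t.1.2.2 else normalizedSum a t.1.1 (t.1.2.1.erase t.1.2.2)

/-- The algebras generated by `a i` (`true`) and by the `a j` with `j ≠ i` (`false`). -/
noncomputable def splitAlgebra (a : ℕ → A) (i : ℕ) (c : Bool) : Subalgebra ℂ A :=
  Algebra.adjoin ℂ (⋃ j ∈ {j | decide (j = i) = c}, (Algebra.adjoin ℂ {a j} : Set A))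

theorem mem_splitAlgebra (a : ℕ → A) {i j : ℕ} {c : Bool} (h : decide (j = i) = c) :
    a j ∈ splitAlgebra a i c := by
  refine Algebra.subset_adjoin (Set.mem_biUnion (x := j) h ?_)
  exact Algebra.subset_adjoin (Set.mem_singleton _)

theorem normalizedSum_erase_mem_splitAlgebra (a : ℕ → A) (N : ℕ) (F : Finset ℕ) (i : ℕ) :
    normalizedSum a N (F.erase i) ∈ splitAlgebra a i false :=
  Subalgebra.smul_mem _ (sum_mem fun j hj => mem_splitAlgebra a
    (by simpa using Finset.ne_of_mem_erase hj)) _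

theorem sumLetter_mem_splitAlgebra (a : ℕ → A) (c : Bool) (t : SumIndex) :
    sumLetter a c t ∈ splitAlgebra a t.1.2.2 c := by
  cases c
  · exact normalizedSum_erase_mem_splitAlgebra a _ _ _
  · exact mem_splitAlgebra a (by simp)

variable {φ : A →L[ℂ] ℂ} {a : ℕ → A}

theorem FreelyIndependent.listFree_splitAlgebra (hfree : FreelyIndependent φ a) (h1 : φ 1 = 1)
    (i : ℕ) : ListFree φ (splitAlgebra a i) :=
  (FreeSubalgebras.listFree hfree).group h1 fun j => decide (j = i)

theorem isBdd_normalization : IsBdd fun t : SumIndex => normalization t.1.1 :=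
  ⟨1, fun _ => norm_normalization_le_one _⟩

/-- The moments of order `k` of all normalized sums of at most `N` elements are bounded. -/
def MomentsBounded (φ : A →L[ℂ] ℂ) (a : ℕ → A) (k : ℕ) : Prop :=
  ∃ C : ℝ, ∀ (N : ℕ) (F : Finset ℕ), F.card ≤ N → ‖φ (normalizedSum a N F ^ k)‖ ≤ C

/-- A single `a i` has weight zero, so its moments of every order must be bounded, but those of the
sums only up to order `k`. -/
theorem WordSpan.isBdd_of_momentsBounded (hfree : FreelyIndependent φ a) (h1 : φ 1 = 1)
    (hbdd : ∀ d, IsBdd fun i => φ (a i ^ d)) {k : ℕ} (hk : ∀ d ≤ k, MomentsBounded φ a d)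
    {u : SumIndex → A} (hu : WordSpan (sumLetter a) falseWeight k u) : IsBdd fun t => φ (u t) := by
  let ℬ : SumIndex → Bool → Subalgebra ℂ A := fun t => splitAlgebra a t.1.2.2
  have hfree' : ∀ t, ListFree φ (ℬ t) := fun t => hfree.listFree_splitAlgebra h1 _
  have hmem : ∀ c t, sumLetter a c t ∈ ℬ t c := sumLetter_mem_splitAlgebra a
  refine hu.isBdd h1 hfree' hmem ?_ le_rfl
  rintro (_ | _) d hd
  · obtain ⟨C, hC⟩ := hk d (by simpa [falseWeight] using hd)
    exact ⟨C, fun t => hC t.1.1 (t.1.2.1.erase t.1.2.2) (Finset.card_erase_le.trans t.2.2)⟩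
  · obtain ⟨C, hC⟩ := hbdd d
    exact ⟨C, fun t => hC t.1.2.2⟩

theorem map_normalizedSum_pow_succ (hfree : FreelyIndependent φ a) (h1 : φ 1 = 1)
    (hmean : ∀ i, φ (a i) = 0) (hvar : ∀ i, φ (a i ^ 2) = 1) (N : ℕ) (F : Finset ℕ) (k : ℕ) :
    φ (normalizedSum a N F ^ (k + 1)) = ∑ i ∈ F, normalization N ^ 2 *
      ((∑ j ∈ Finset.range k, φ (normalizedSum a N (F.erase i) ^ j) *
        φ (normalizedSum a N (F.erase i) ^ (k - 1 - j))) + normalization N *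
        φ (a i * powRemainder₂ (a i) (normalizedSum a N (F.erase i)) (normalization N) k)) := by
  have e : normalizedSum a N F ^ (k + 1) =
      ∑ i ∈ F, normalization N • (a i * normalizedSum a N F ^ k) := by
    rw [pow_succ', ← Finset.smul_sum, ← Finset.sum_mul, ← smul_mul_assoc]
    rfl
  rw [e, map_sum]
  refine Finset.sum_congr rfl fun i hi => ?_
  rw [normalizedSum_eq_erase a N hi, map_smul,
    (hfree.listFree_splitAlgebra h1 i).map_mul_add_pow h1 (mem_splitAlgebra a (by simp)) (hmean i)
      (hvar i) (normalizedSum_erase_mem_splitAlgebra a N F i), smul_eq_mul]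
  ring

theorem exists_bound_remainder₂ (hfree : FreelyIndependent φ a) (h1 : φ 1 = 1)
    (hbdd : ∀ d, IsBdd fun i => φ (a i ^ d)) {k : ℕ} (hk : ∀ d ≤ k, MomentsBounded φ a d) :
    ∃ C : ℝ, 0 ≤ C ∧ ∀ (N : ℕ) (F : Finset ℕ), F.card ≤ N → ∀ i ∈ F,
      ‖φ (a i * powRemainder₂ (a i) (normalizedSum a N (F.erase i)) (normalization N) k)‖ ≤ C := by
  obtain ⟨C, hC⟩ := (wordSpan_powRemainder₂ (z := sumLetter a) isBdd_normalization
    k).true_mul.isBdd_of_momentsBounded hfree h1 hbdd hk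
  exact ⟨max C 0, le_max_right _ _, fun N F hF i hi =>
    (hC ⟨(N, F, i), hi, hF⟩).trans (le_max_left _ _)⟩

/-- The exact recursion has at most `N` summands, each of size `O(1/N)` by the lower order bounds.
It involves `F.erase i` under the same normalization, which is why `F` ranges over all sets of at
most `N` indices. -/
theorem momentsBounded (hfree : FreelyIndependent φ a) (h1 : φ 1 = 1)
    (hmean : ∀ i, φ (a i) = 0) (hvar : ∀ i, φ (a i ^ 2) = 1)
    (hbdd : ∀ d, IsBdd fun i => φ (a i ^ d)) (k : ℕ) : MomentsBounded φ a k := by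
  induction k using Nat.strong_induction_on with
  | _ k ih =>
  match k with
  | 0 => exact ⟨1, fun N F _ => by simp [h1]⟩
  | k + 1 =>
    have hk : ∀ d ≤ k, MomentsBounded φ a d := fun d hd => ih d (Nat.lt_succ_of_le hd)
    obtain ⟨C, hC0, hC⟩ := exists_bound_remainder₂ hfree h1 hbdd hk
    choose! B hB using hk
    refine ⟨(∑ j ∈ Finset.range k, B j * B (k - 1 - j)) + C, fun N F hF => ?_⟩
    rw [map_normalizedSum_pow_succ hfree h1 hmean hvar]
    have hnn : 0 ≤ (∑ j ∈ Finset.range k, B j * B (k - 1 - j)) + C := by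
      refine add_nonneg (Finset.sum_nonneg fun j hj => ?_) hC0
      rw [Finset.mem_range] at hj
      exact mul_nonneg ((norm_nonneg _).trans (hB j hj.le N F hF))
        ((norm_nonneg _).trans (hB (k - 1 - j) (by omega) N F hF))
    calc _ ≤ ∑ i ∈ F, ‖normalization N‖ ^ 2 *
          ((∑ j ∈ Finset.range k, B j * B (k - 1 - j)) + C) := ?_
      _ = F.card * ‖normalization N‖ ^ 2 * ((∑ j ∈ Finset.range k, B j * B (k - 1 - j)) + C) := by
        rw [Finset.sum_const, nsmul_eq_mul, mul_assoc]
      _ ≤ _ := mul_le_of_le_one_left hnn (card_mul_norm_normalization_sq_le hF)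
    refine norm_sum_le_of_le _ fun i hi => ?_
    have hF' : (F.erase i).card ≤ N := Finset.card_erase_le.trans hF
    rw [norm_mul, norm_pow]
    refine mul_le_mul_of_nonneg_left ?_ (by positivity)
    refine (norm_add_le _ _).trans (add_le_add (norm_sum_le_of_le _ fun j hj => ?_) ?_)
    · rw [Finset.mem_range] at hj
      have hj1 := hB j hj.le N _ hF'
      rw [norm_mul]
      exact mul_le_mul hj1 (hB (k - 1 - j) (by omega) N _ hF') (norm_nonneg _)
        ((norm_nonneg _).trans hj1)
    · rw [norm_mul]
      exact (mul_le_of_le_one_left (norm_nonneg _) (norm_normalization_le_one N)).trans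
        (hC N F hF i hi)

/-- Removing one summand is a perturbation of order `1/√N`, and the first order remainder has
bounded expectation. -/
theorem exists_bound_erase (hfree : FreelyIndependent φ a) (h1 : φ 1 = 1)
    (hbdd : ∀ d, IsBdd fun i => φ (a i ^ d)) (hmom : ∀ k, MomentsBounded φ a k) (k : ℕ) :
    ∃ C : ℝ, ∀ (N : ℕ) (F : Finset ℕ), F.card ≤ N → ∀ i ∈ F,
      ‖φ (normalizedSum a N (F.erase i) ^ k) - φ (normalizedSum a N F ^ k)‖ ≤
        ‖normalization N‖ * C := by
  obtain ⟨C, hC⟩ := (wordSpan_powRemainder₁ (z := sumLetter a) isBdd_normalization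
    k).isBdd_of_momentsBounded hfree h1 hbdd fun d _ => hmom d
  refine ⟨C, fun N F hF i hi => ?_⟩
  rw [normalizedSum_eq_erase a N hi, add_smul_pow_eq₁, map_add, map_smul, sub_add_cancel_left,
    norm_neg, norm_smul]
  exact mul_le_mul_of_nonneg_left (hC ⟨(N, F, i), hi, hF⟩) (norm_nonneg _)

theorem norm_mul_sub_mul_le {x x' y y' : ℂ} {d d' M M' : ℝ} (hx : ‖x - x'‖ ≤ d)
    (hy : ‖y - y'‖ ≤ d') (hx' : ‖x'‖ ≤ M) (hyM : ‖y‖ ≤ M') :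
    ‖x * y - x' * y'‖ ≤ d * M' + M * d' := by
  have e : x * y - x' * y' = (x - x') * y + x' * (y - y') := by ring
  rw [e]
  refine (norm_add_le _ _).trans (add_le_add ?_ ?_) <;> rw [norm_mul]
  · exact mul_le_mul hx hyM (norm_nonneg _) ((norm_nonneg _).trans hx)
  · exact mul_le_mul hx' hy (norm_nonneg _) ((norm_nonneg _).trans hx')

/-- The moments of the normalized sums satisfy the recursion of the Catalan numbers up to an error
of order `1 / √N`. -/
theorem exists_bound_moment_recursion (hfree : FreelyIndependent φ a) (h1 : φ 1 = 1)
    (hmean : ∀ i, φ (a i) = 0) (hvar : ∀ i, φ (a i ^ 2) = 1)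
    (hbdd : ∀ d, IsBdd fun i => φ (a i ^ d)) (k : ℕ) : ∃ C : ℝ, ∀ N : ℕ, N ≠ 0 →
    ‖φ (normalizedSum a N (Finset.range N) ^ (k + 1)) - ∑ j ∈ Finset.range k,
      φ (normalizedSum a N (Finset.range N) ^ j) *
        φ (normalizedSum a N (Finset.range N) ^ (k - 1 - j))‖ ≤ ‖normalization N‖ * C := by
  have hmom := momentsBounded hfree h1 hmean hvar hbdd
  obtain ⟨C, hC0, hC⟩ := exists_bound_remainder₂ hfree h1 hbdd fun d (_ : d ≤ k) => hmom d
  choose E hE using exists_bound_erase hfree h1 hbdd hmom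
  choose B hB using hmom
  refine ⟨(∑ j ∈ Finset.range k, (E j * B (k - 1 - j) + B j * E (k - 1 - j))) + C,
    fun N hN => ?_⟩
  have hF : (Finset.range N).card ≤ N := (Finset.card_range N).le
  have hone : ∑ i ∈ Finset.range N, normalization N ^ 2 = 1 := by
    rw [Finset.sum_const, Finset.card_range, nsmul_eq_mul, mul_normalization_sq hN]
  have hone' : ∑ i ∈ Finset.range N, ‖normalization N‖ ^ 2 = 1 := by
    rw [Finset.sum_const, Finset.card_range, nsmul_eq_mul, ← norm_pow]
    have := congrArg norm (mul_normalization_sq hN)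
    simpa using this
  set m : ℕ → ℂ := fun j => φ (normalizedSum a N (Finset.range N) ^ j) with hm
  -- Spreading the target over `N` equal shares `1/N` allows a comparison summand by summand.
  have e : ∑ j ∈ Finset.range k, m j * m (k - 1 - j) = ∑ i ∈ Finset.range N,
      normalization N ^ 2 * ∑ j ∈ Finset.range k, m j * m (k - 1 - j) := by
    rw [← Finset.sum_mul, hone, one_mul]
  change ‖_ - ∑ j ∈ Finset.range k, m j * m (k - 1 - j)‖ ≤ _
  rw [map_normalizedSum_pow_succ hfree h1 hmean hvar, e, ← Finset.sum_sub_distrib]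
  set K := (∑ j ∈ Finset.range k, (E j * B (k - 1 - j) + B j * E (k - 1 - j))) + C with hK
  rw [← one_mul (‖normalization N‖ * K), ← hone', Finset.sum_mul]
  refine norm_sum_le_of_le _ fun i hi => ?_
  have hF' : ((Finset.range N).erase i).card ≤ N := Finset.card_erase_le.trans hF
  rw [← mul_sub, norm_mul, norm_pow, hK, mul_add ‖normalization N‖, Finset.mul_sum]
  refine mul_le_mul_of_nonneg_left ?_ (by positivity)
  rw [add_sub_right_comm, ← Finset.sum_sub_distrib]
  refine (norm_add_le _ _).trans (add_le_add (norm_sum_le_of_le _ fun j hj => ?_) ?_)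
  · refine (norm_mul_sub_mul_le (hE j N _ hF i hi) (hE (k - 1 - j) N _ hF i hi) (hB j N _ hF)
      (hB (k - 1 - j) N _ hF')).trans_eq ?_
    ring
  · rw [norm_mul]
    exact mul_le_mul_of_nonneg_left (hC N _ hF i hi) (norm_nonneg _)

theorem tendsto_moments (hfree : FreelyIndependent φ a) (h1 : φ 1 = 1)
    (hmean : ∀ i, φ (a i) = 0) (hvar : ∀ i, φ (a i ^ 2) = 1)
    (hbdd : ∀ d, IsBdd fun i => φ (a i ^ d)) (k : ℕ) :
    Tendsto (fun N => φ (normalizedSum a N (Finset.range N) ^ k)) atTop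
      (𝓝 (semicircleMoment k : ℂ)) := by
  induction k using Nat.strong_induction_on with
  | _ k ih =>
  match k with
  | 0 => simp [h1, semicircleMoment_zero]
  | k + 1 =>
    obtain ⟨C, hC⟩ := exists_bound_moment_recursion hfree h1 hmean hvar hbdd k
    have h0 : Tendsto (fun N => φ (normalizedSum a N (Finset.range N) ^ (k + 1)) -
        ∑ j ∈ Finset.range k, φ (normalizedSum a N (Finset.range N) ^ j) *
          φ (normalizedSum a N (Finset.range N) ^ (k - 1 - j))) atTop (𝓝 0) := by
      refine squeeze_zero_norm' ?_ (by simpa using tendsto_normalization.mul_const C)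
      filter_upwards [eventually_ne_atTop 0] with N hN using hC N hN
    have hs := tendsto_finsetSum (Finset.range k) fun j hj =>
      (ih j (by rw [Finset.mem_range] at hj; omega)).mul
        (ih (k - 1 - j) (by rw [Finset.mem_range] at hj; omega))
    have h := h0.add hs
    simp only [sub_add_cancel, zero_add] at h
    rw [semicircleMoment_succ]
    push_cast
    exact h

end CentralLimit

end FreeProb

theorem mainTheorem1 {A : Type*} [CStarAlgebra A] (φ : A →L[ℂ] ℂ) (hφ : FreeProb.IsState φ)
    (a : ℕ → A) (hsa : ∀ i, IsSelfAdjoint (a i))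
    (hfree : FreeProb.FreelyIndependent φ a)
    (hmean : ∀ i, φ (a i) = 0) (hvar : ∀ i, φ (a i ^ 2) = 1)
    (μ : MeasureTheory.ProbabilityMeasure ℝ) (hlaw : ∀ i, FreeProb.IsLaw φ (a i) μ)
    (hthird : MeasureTheory.Integrable (fun x : ℝ => |x| ^ 3) (μ : MeasureTheory.Measure ℝ)) :
    ∃ (B : Type) (_ : CStarAlgebra B) (ψ : B →L[ℂ] ℂ) (s : B),
      FreeProb.IsState ψ ∧ FreeProb.IsSemicircular ψ s ∧
      FreeProb.ConvergesInDistribution φ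
        (fun N : ℕ => ((1 / Real.sqrt N : ℝ) : ℂ) • ∑ i ∈ Finset.range N, a i) ψ s := by
  -- Unitality is the zeroth moment of the probability measure `μ`.
  have h1 : φ 1 = 1 := by simpa using (hlaw 0 0).2
  have hbdd : ∀ d, FreeProb.IsBdd fun i => φ (a i ^ d) := fun d =>
    ⟨‖φ (a 0 ^ d)‖, fun i => (congrArg norm ((hlaw i d).2.trans (hlaw 0 d).2.symm)).le⟩
  have hconv := FreeProb.tendsto_moments hfree h1 hmean hvar hbdd
  have hsum : ∀ N : ℕ, IsSelfAdjoint (FreeProb.normalizedSum a N (Finset.range N)) := fun N =>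
    IsSelfAdjoint.smul (Complex.conj_ofReal _) (isSelfAdjoint_sum _ fun i _ => hsa i)
  have hsemi := FreeProb.isSemicircular_semicircleElement
  choose ν hν using fun N => FreeProb.exists_isLaw_of_isSelfAdjoint hφ h1 (hsum N)
  refine ⟨C(Set.Icc (-2 : ℝ) 2, ℂ), inferInstance, FreeProb.semicircleState,
    FreeProb.semicircleElement, FreeProb.isState_semicircleState, hsemi, fun k => ?_, ν,
    FreeProb.semicircleLaw, hν, hsemi.2, ?_⟩
  · rw [(hsemi.2 k).2]
    exact hconv k
  · refine FreeProb.tendsto_of_tendsto_moments zero_le_two (fun N n => (hν N n).1)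
      FreeProb.integrable_pow_semicircleLaw FreeProb.semicircleMoment_two_mul_le fun n => ?_
    have h := (Complex.continuous_re.tendsto _).comp (hconv n)
    simp only [Function.comp_def, (hν _ n).2, Complex.ofReal_re] at h
    exact h
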